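/- Let $N,n,m\in\mathbb{N}$, let $(\Omega,\mathcal F,\mathbb P)$ be a probability space, $A\in\mathbb{R}^{n\times n}$, and let $\boldsymbol B(0),\dots,\boldsymbol B(N-1)$ be random $n\times m$ real matrices each of whose entries has finite expectation and variance. For a known initial condition $x(0)\in\mathbb{R}^n$ and an open-loop control $U=(u(0),\dots,u(N-1))\in(\mathbb{R}^m)^N$ let $$\boldsymbol x(k+1)=A\boldsymbol x(k)+\boldsymbol B(k)u(k),\qquad k=0,\dots,N-1 .$$ For $1\le k\le N$ and $1\le i\le q_k$ let $G_{ki}\in\mathbb{R}^{1\times n}$ and $h_{ki}\in\mathbb{R}$, and suppose that each real random variable $G_{ki}\boldsymbol x(k)$ is unimodal, i.e. there is $a\in\mathbb{R}$ (depending on $k,i$) such that its cumulative distribution function is convex on $(-\infty,a)$ and concave on $(a,\infty)$. Let $\alpha<1/6$. If there are real numbers $\lambda_{ki}\ge 0$ such that $$\mathbb{E}[G_{ki}\boldsymbol x(k)]+\lambda_{ki}\,\mathrm{std}(G_{ki}\boldsymbol x(k))\le h_{ki}\quad\text{for all } 1\le k\le N,\ 1\le i\le q_k,$$ where $\mathrm{std}$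 denotes the standard deviation, and $$\sum_{k=1}^N\sum_{i=1}^{q_k}\frac{4}{9(\lambda_{ki}^2+1)}\le\alpha ,$$ then $$\mathbb{P}\Big(\bigcap_{k=1}^N\bigcap_{i=1}^{q_k}\{G_{ki}\boldsymbol x(k)\le h_{ki}\}\Big)\ge 1-\alpha .$$ -/

import Mathlib

open MeasureTheory ProbabilityTheory
open scoped Matrix

/-- A distribution on the real line is unimodal if, for some `a`, its cumulative distribution
function is convex on `(-∞, a)` and concave on `(a, ∞)`. -/
def IsUnimodal (ν : Measure ℝ) : Prop :=
  ∃ a : ℝ, ConvexOn ℝ (Set.Iio a) (fun t => cdf ν t) ∧ ConcaveOn ℝ (Set.Ioi a) (fun t => cdf ν t)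

/-- The state at the times `0, …, N` of the system `x(k+1) = A x(k) + B(k) u(k)` with random control
matrices `B(0), …, B(N-1)`, known initial condition `x₀` and open-loop control
`U = (u(0), …, u(N-1))`. -/
def state {Ω : Type*} {n m N : ℕ} (A : Matrix (Fin n) (Fin n) ℝ)
    (B : Fin N → Ω → Matrix (Fin n) (Fin m) ℝ) (x₀ : Fin n → ℝ) (U : Fin N → Fin m → ℝ)
    (k : Fin (N + 1)) (ω : Ω) : Fin n → ℝ :=
  Fin.induction (motive := fun _ => Fin n → ℝ) x₀ (fun j x => A *ᵥ x + B j ω *ᵥ U j) k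

/-- The standard deviation of a real random variable. -/
noncomputable def std {Ω : Type*} [MeasurableSpace Ω] (P : Measure Ω) (X : Ω → ℝ) : ℝ :=
  Real.sqrt (variance X P)

/-- The random variable `G_{ki} x(k)`. The index `k : Fin N` stands for the time `k + 1`, so that
the constrained times are `1, …, N`. -/
def constraintVar {Ω : Type*} {n m N : ℕ} (A : Matrix (Fin n) (Fin n) ℝ)
    (B : Fin N → Ω → Matrix (Fin n) (Fin m) ℝ) (x₀ : Fin n → ℝ) (U : Fin N → Fin m → ℝ)
    {q : Fin N → ℕ} (G : (k : Fin N) → Fin (q k) → Fin n → ℝ)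
    (k : Fin N) (i : Fin (q k)) (ω : Ω) : ℝ :=
  G k i ⬝ᵥ state A B x₀ U k.succ ω

/-! By the union bound it suffices to bound each violation probability by `4 / (9 * (λ ^ 2 + 1))`.
Every such term is at most `α < 1/6`, so `λ ^ 2 > 5/3`, the range where the one-sided
Vysochanskij–Petunin inequality holds (`measureReal_lt_le_of_isUnimodal`). A unimodal law is, up to
an atom at the mode, a mixture of uniform laws on intervals ending at the mode. Hence a test
function with nonnegative value at the mode and nonnegative integral over each such interval has
nonnegative expectation (`integral_nonneg_of_convexOn_of_concaveOn`). Applied to `A y² + B - C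
1_{y>1}`, with coefficients depending on the mode, this gives `p ≤ 4s/9` for tail `p` and second
moment `s ≤ 3/8` (`IsUnimodal.tail_le`). Cantelli's shift makes `s = 1/(λ²+1)`. -/

/-! ### Monotone densities on a half-line. -/

theorem AntitoneOn.measurable_indicator_Ioi {a : ℝ} {g : ℝ → ℝ} (hg : AntitoneOn g (Set.Ioi a))
    (hg0 : ∀ x ∈ Set.Ioi a, 0 ≤ g x) : Measurable ((Set.Ioi a).indicator g) := by
  refine measurable_of_Ioi fun s => ?_
  by_cases hs : s < 0
  · convert MeasurableSet.univ
    refine Set.eq_univ_of_forall fun x => lt_of_lt_of_le hs ?_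
    exact Set.indicator_nonneg hg0 x
  · refine Set.OrdConnected.measurableSet ⟨fun x hx y hy z hz => ?_⟩
    have key : ∀ w, s < (Set.Ioi a).indicator g w → w ∈ Set.Ioi a := by
      intro w hw
      by_contra h
      rw [Set.indicator_of_notMem h] at hw
      exact hs hw
    have hxa := key x hx
    have hya := key y hy
    have hza : z ∈ Set.Ioi a := lt_of_lt_of_le hxa hz.1
    simp only [Set.mem_preimage, Set.mem_Ioi] at hx hy ⊢
    rw [Set.indicator_of_mem hza]
    rw [Set.indicator_of_mem hya] at hy
    exact hy.trans_le (hg hza hya hz.2)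

/-- A measure with concave distribution function on a half-line has an antitone density there. -/
theorem exists_antitoneOn_density {ν : Measure ℝ} [IsFiniteMeasure ν] {F : ℝ → ℝ} {a : ℝ}
    (hF : ConcaveOn ℝ (Set.Ioi a) F)
    (hν : ∀ x y, a < x → x ≤ y → ν.real (Set.Ioc x y) = F y - F x) :
    ∃ g : ℝ → ℝ, Measurable g ∧ (∀ x, 0 ≤ g x) ∧ AntitoneOn g (Set.Ioi a) ∧
      ν.restrict (Set.Ioi a) =
        (volume.withDensity (fun x => ENNReal.ofReal (g x))).restrict (Set.Ioi a) := by
  set r : ℝ → ℝ := fun x => - derivWithin (-F) (Set.Ioi x) x with hr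
  have hc : ConvexOn ℝ (Set.Ioi a) (-F) := hF.neg
  have hd : ∀ x ∈ Set.Ioi a, HasDerivWithinAt F (r x) (Set.Ioi x) x := by
    intro x hx
    have := (hc.hasDerivWithinAt_rightDeriv_of_mem_interior
      (x := x) (by rwa [isOpen_Ioi.interior_eq])).neg
    simpa using this
  have hanti : AntitoneOn r (Set.Ioi a) := by
    have := hc.monotoneOn_rightDeriv
    rw [isOpen_Ioi.interior_eq] at this
    exact this.neg
  have hmono : MonotoneOn F (Set.Ioi a) := by
    intro x hx y hy hxy
    have := hν x y hx hxy
    have h0 : 0 ≤ ν.real (Set.Ioc x y) := measureReal_nonneg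
    linarith
  have hr0 : ∀ x ∈ Set.Ioi a, 0 ≤ r x := by
    intro x hx
    rw [← (hd x hx).derivWithin (uniqueDiffWithinAt_Ioi x)]
    exact (hmono.mono (Set.Ioi_subset_Ioi (le_of_lt hx))).derivWithin_nonneg
  have hcont : ContinuousOn F (Set.Ioi a) := hF.continuousOn isOpen_Ioi
  set g := (Set.Ioi a).indicator r with hg
  have hgr : Set.EqOn g r (Set.Ioi a) := fun x hx => Set.indicator_of_mem hx _
  have hgm : Measurable g := hanti.measurable_indicator_Ioi hr0
  refine ⟨g, hgm, Set.indicator_nonneg hr0, hanti.congr hgr.symm, ?_⟩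
  have key : ∀ x y, a < x → x ≤ y →
      ν (Set.Ioc x y) = (volume.withDensity (fun x => ENNReal.ofReal (g x))) (Set.Ioc x y) := by
    intro x y hx hxy
    have hsub : Set.Icc x y ⊆ Set.Ioi a := fun t ht => lt_of_lt_of_le hx ht.1
    have hint : IntervalIntegrable r volume x y := by
      apply AntitoneOn.intervalIntegrable
      rw [Set.uIcc_of_le hxy]
      exact hanti.mono hsub
    have h1 := intervalIntegral.integral_eq_sub_of_hasDeriv_right_of_le hxy (hcont.mono hsub)
      (fun t ht => hd t (hsub (Set.Ioo_subset_Icc_self ht))) hint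
    rw [intervalIntegral.integral_of_le hxy, ← hν x y hx hxy] at h1
    have hsub' : Set.Ioc x y ⊆ Set.Ioi a := Set.Ioc_subset_Icc_self.trans hsub
    rw [withDensity_apply _ measurableSet_Ioc,
      setLIntegral_congr_fun (g := fun t => ENNReal.ofReal (r t)) measurableSet_Ioc
        (fun t ht => by simp only [hgr (hsub' ht)]),
      ← ofReal_integral_eq_lintegral_ofReal, h1, ofReal_measureReal]
    · exact (intervalIntegrable_iff_integrableOn_Ioc_of_le hxy).1 hint
    · exact (ae_restrict_iff' measurableSet_Ioc).2 (Filter.Eventually.of_forall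
        fun t ht => hr0 t (hsub' ht))
  -- `key` needs left endpoints strictly above `a`, near which the density may blow up, so the
  -- half-line is exhausted from the right.
  have hU : Set.Ioi a = ⋃ n : ℕ, Set.Ioi (a + 1 / ((n : ℝ) + 1)) := by
    ext x
    simp only [Set.mem_Ioi, Set.mem_iUnion]
    constructor
    · intro h
      obtain ⟨n, hn⟩ := exists_nat_one_div_lt (sub_pos.2 h)
      exact ⟨n, by linarith⟩
    · rintro ⟨n, hn⟩
      have : (0 : ℝ) < 1 / ((n : ℝ) + 1) := by positivity
      linarith
  rw [hU, Measure.restrict_iUnion_congr]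
  intro n
  have hn : (0 : ℝ) < 1 / ((n : ℝ) + 1) := by positivity
  refine Measure.ext_of_Ioc' _ _ (fun x y _ => measure_ne_top _ _) fun x y hxy => ?_
  rw [Measure.restrict_apply measurableSet_Ioc, Measure.restrict_apply measurableSet_Ioc,
    Set.Ioc_inter_Ioi]
  rcases le_or_gt (x ⊔ (a + 1 / ((n : ℝ) + 1))) y with h | h
  · exact key _ _ (lt_of_lt_of_le (by linarith) le_sup_right) h
  · rw [Set.Ioc_eq_empty (not_lt.2 h.le)]; simp

/-! ### Unimodal laws as mixtures of uniform laws. -/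

/-- The superlevel sets of a nonnegative integrable antitone function on a half-line are, up to null
sets, intervals that start at the endpoint. -/
theorem AntitoneOn.superlevel_ae_eq_Ioc {a s : ℝ} {g : ℝ → ℝ} (hg0 : ∀ x, 0 ≤ g x)
    (hanti : AntitoneOn g (Set.Ioi a)) (hgi : IntegrableOn g (Set.Ioi a)) (hs : 0 < s)
    (hne : ({x | s < g x} ∩ Set.Ioi a).Nonempty) :
    ∃ z, a < z ∧ ({x | s < g x} ∩ Set.Ioi a : Set ℝ) =ᵐ[volume] Set.Ioc a z := by
  set S : Set ℝ := {x | s < g x} ∩ Set.Ioi a with hS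
  have hbdd : BddAbove S := by
    -- Markov's inequality: `g > s` on all of `(a, y]`, so `s * (y - a) ≤ ∫ g`.
    refine ⟨a + (∫ x in Set.Ioi a, g x) / s, fun y hy => ?_⟩
    have hya : a < y := hy.2
    have h1 : ∫ x in Set.Ioc a y, s ≤ ∫ x in Set.Ioc a y, g x := by
      refine setIntegral_mono_on (integrableOn_const (by simp))
        (hgi.mono_set Set.Ioc_subset_Ioi_self) measurableSet_Ioc fun x hx => ?_
      exact (le_of_lt hy.1).trans (hanti hx.1 hya hx.2)
    have h2 : ∫ x in Set.Ioc a y, g x ≤ ∫ x in Set.Ioi a, g x :=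
      setIntegral_mono_set hgi (Filter.Eventually.of_forall hg0)
        (LE.le.eventuallyLE Set.Ioc_subset_Ioi_self)
    rw [setIntegral_const, Real.volume_real_Ioc_of_le hya.le, smul_eq_mul] at h1
    have : y - a ≤ (∫ x in Set.Ioi a, g x) / s := by
      rw [le_div_iff₀ hs]; linarith
    linarith
  refine ⟨sSup S, ?_, ?_⟩
  · obtain ⟨y, hy⟩ := hne
    exact lt_of_lt_of_le hy.2 (le_csSup hbdd hy)
  · refine Filter.EventuallyLE.antisymm (LE.le.eventuallyLE ?_) ?_
    · exact fun y hy => ⟨hy.2, le_csSup hbdd hy⟩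
    · refine Ioo_ae_eq_Ioc.symm.le.trans (LE.le.eventuallyLE fun x hx => ?_)
      obtain ⟨y, hy, hxy⟩ := exists_lt_of_lt_csSup hne hx.2
      exact ⟨lt_of_lt_of_le hy.1 (hanti hx.1 hy.2 hxy.le), hx.1⟩

/-- Layer cake: `g x = ∫_{s>0} 1_{s < g x}`, and by Fubini the integral becomes an average over `s`
of integrals of `φ` over superlevel sets, which are intervals starting at `a`. -/
theorem setIntegral_mul_nonneg_of_antitoneOn {a : ℝ} {g φ : ℝ → ℝ} (hgm : Measurable g)
    (hg0 : ∀ x, 0 ≤ g x) (hanti : AntitoneOn g (Set.Ioi a)) (hgi : IntegrableOn g (Set.Ioi a))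
    (hφm : Measurable φ) (hφg : IntegrableOn (fun x => φ x * g x) (Set.Ioi a))
    (h : ∀ z, a < z → 0 ≤ ∫ x in Set.Ioc a z, φ x) :
    0 ≤ ∫ x in Set.Ioi a, φ x * g x := by
  set K : ℝ → ℝ → ℝ := fun x s => (Set.Iio (g x)).indicator (fun _ => φ x) s with hK
  have hKm : Measurable (Function.uncurry K) := by
    have : Function.uncurry K = {p : ℝ × ℝ | p.2 < g p.1}.indicator (fun p => φ p.1) := by
      ext ⟨x, s⟩
      simp [K, Set.indicator]
    rw [this]
    exact (hφm.comp measurable_fst).indicator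
      (measurableSet_lt measurable_snd (hgm.comp measurable_fst))
  have hvol : ∀ x, (volume.restrict (Set.Ioi (0 : ℝ))).real (Set.Iio (g x)) = g x := by
    intro x
    rw [measureReal_restrict_apply measurableSet_Iio]
    have : (Set.Iio (g x)) ∩ Set.Ioi (0 : ℝ) = Set.Ioo 0 (g x) := by
      ext s; simp [and_comm]
    rw [this, Real.volume_real_Ioo_of_le (hg0 x), sub_zero]
  have hfin : ∀ x, (volume.restrict (Set.Ioi (0 : ℝ))) (Set.Iio (g x)) ≠ ⊤ := by
    intro x
    rw [Measure.restrict_apply measurableSet_Iio]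
    refine ne_top_of_le_ne_top (b := volume (Set.Icc 0 (g x))) (by simp) (measure_mono ?_)
    exact fun s hs => ⟨le_of_lt hs.2, le_of_lt hs.1⟩
  have hKint : ∀ x, ∫ s in Set.Ioi (0 : ℝ), K x s = φ x * g x := by
    intro x
    rw [integral_indicator_const _ measurableSet_Iio, hvol, smul_eq_mul, mul_comm]
  have hKi : Integrable (Function.uncurry K)
      ((volume.restrict (Set.Ioi a)).prod (volume.restrict (Set.Ioi (0 : ℝ)))) := by
    rw [integrable_prod_iff hKm.aestronglyMeasurable]
    refine ⟨Filter.Eventually.of_forall fun x => ?_, ?_⟩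
    · exact (integrable_indicator_iff measurableSet_Iio).2 
        (integrableOn_const (C := φ x) (hfin x))
    · refine hφg.norm.congr (Filter.Eventually.of_forall fun x => ?_)
      have : (fun s => ‖Function.uncurry K (x, s)‖)
          = (Set.Iio (g x)).indicator (fun _ => ‖φ x‖) := by
        ext s
        simp only [Function.uncurry, K, norm_indicator_eq_indicator_norm]
      simp only [this]
      rw [integral_indicator_const _ measurableSet_Iio, hvol, smul_eq_mul, norm_mul,
        Real.norm_of_nonneg (hg0 x), mul_comm]
  calc (0 : ℝ) ≤ ∫ s in Set.Ioi (0 : ℝ), ∫ x in Set.Ioi a, K x s := by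
        refine setIntegral_nonneg measurableSet_Ioi fun s hs => ?_
        have : (fun x => K x s) = {x | s < g x}.indicator φ := by
          ext x; simp [K, Set.indicator]
        rw [this, integral_indicator (measurableSet_lt measurable_const hgm),
          Measure.restrict_restrict (measurableSet_lt measurable_const hgm)]
        rcases Set.eq_empty_or_nonempty ({x | s < g x} ∩ Set.Ioi a) with he | hne
        · simp [he]
        · obtain ⟨z, hz, hae⟩ := hanti.superlevel_ae_eq_Ioc hg0 hgi hs hne
          rw [setIntegral_congr_set hae]
          exact h z hz
    _ = ∫ x in Set.Ioi a, ∫ s in Set.Ioi (0 : ℝ), K x s := (integral_integral_swap hKi).symm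
    _ = ∫ x in Set.Ioi a, φ x * g x := by simp only [hKint]

theorem setIntegral_Ioi_nonneg_of_concaveOn {ν : Measure ℝ} [IsFiniteMeasure ν] {F φ : ℝ → ℝ}
    {a : ℝ} (hF : ConcaveOn ℝ (Set.Ioi a) F)
    (hν : ∀ x y, a < x → x ≤ y → ν.real (Set.Ioc x y) = F y - F x)
    (hφm : Measurable φ) (hφi : Integrable φ ν)
    (h : ∀ z, a < z → 0 ≤ ∫ x in Set.Ioc a z, φ x) :
    0 ≤ ∫ x in Set.Ioi a, φ x ∂ν := by
  obtain ⟨g, hgm, hg0, hanti, hg⟩ := exists_antitoneOn_density hF hν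
  have hgm' : Measurable fun x => ENNReal.ofReal (g x) := hgm.ennreal_ofReal
  rw [restrict_withDensity measurableSet_Ioi] at hg
  have hgi : IntegrableOn g (Set.Ioi a) := by
    have : IsFiniteMeasure ((volume.restrict (Set.Ioi a)).withDensity
        fun x => ENNReal.ofReal (g x)) := by
      rw [← hg]; infer_instance
    have h1 := measure_lt_top ((volume.restrict (Set.Ioi a)).withDensity
        fun x => ENNReal.ofReal (g x)) Set.univ
    rw [withDensity_apply _ MeasurableSet.univ, Measure.restrict_univ] at h1
    refine ⟨hgm.aestronglyMeasurable, ?_⟩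
    rw [hasFiniteIntegral_iff_ofReal (Filter.Eventually.of_forall hg0)]
    exact h1
  have hφ' := hφi.restrict (s := Set.Ioi a)
  rw [hg, integrable_withDensity_iff hgm' (Filter.Eventually.of_forall fun x => by simp)] at hφ'
  simp only [ENNReal.toReal_ofReal (hg0 _)] at hφ'
  rw [hg, integral_withDensity_eq_integral_toReal_smul hgm'
    (Filter.Eventually.of_forall fun x => by simp)]
  simp only [ENNReal.toReal_ofReal (hg0 _), smul_eq_mul, mul_comm (g _)]
  exact setIntegral_mul_nonneg_of_antitoneOn hgm hg0 hanti hgi hφm hφ' h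

/-- Reflection `x ↦ -x` reduces this to the concave half-line. -/
theorem setIntegral_Iio_nonneg_of_convexOn {ν : Measure ℝ} [IsProbabilityMeasure ν] {φ : ℝ → ℝ}
    {a : ℝ} (hF : ConvexOn ℝ (Set.Iio a) (fun t => cdf ν t))
    (hφm : Measurable φ) (hφi : Integrable φ ν)
    (h : ∀ z, z < a → 0 ≤ ∫ x in Set.Ioc z a, φ x) :
    0 ≤ ∫ x in Set.Iio a, φ x ∂ν := by
  have hcont : ContinuousOn (fun t => cdf ν t) (Set.Iio a) := hF.continuousOn isOpen_Iio
  have hprob : IsProbabilityMeasure (ν.map Neg.neg) :=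
    Measure.isProbabilityMeasure_map measurable_neg.aemeasurable
  -- Reflection turns `Ioc` into `Ico`, whose mass involves left limits; convexity makes the cdf
  -- continuous below `a`.
  have hleft : ∀ x, x < a → Function.leftLim (cdf ν) x = cdf ν x := by
    intro x hx
    have := (hcont.continuousAt (Iio_mem_nhds hx)).continuousWithinAt (s := Set.Iio x)
    exact leftLim_eq_of_tendsto this
  have hconc : ConcaveOn ℝ (Set.Ioi (-a)) (fun t => - cdf ν (-t)) := by
    have h1 := (hF.comp_linearMap (-LinearMap.id)).neg
    have h2 : (-LinearMap.id : ℝ →ₗ[ℝ] ℝ) ⁻¹' Set.Iio a = Set.Ioi (-a) := by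
      ext x
      simp [neg_lt]
    rw [h2] at h1
    exact h1
  have key := setIntegral_Ioi_nonneg_of_concaveOn (ν := ν.map Neg.neg)
    (φ := fun x => φ (-x)) hconc ?_ (hφm.comp measurable_neg) ?_ ?_
  · have hme : MeasurableEmbedding (Neg.neg : ℝ → ℝ) :=
      (MeasurableEquiv.neg ℝ).measurableEmbedding
    rw [hme.setIntegral_map] at key
    simpa using key
  · intro x y hx hxy
    rw [map_measureReal_apply measurable_neg measurableSet_Ioc]
    have : Neg.neg ⁻¹' Set.Ioc x y = Set.Ico (-y) (-x) := by
      ext t; simp [and_comm]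
    rw [this, measureReal_def]
    nth_rewrite 1 [← measure_cdf ν]
    rw [StieltjesFunction.measure_Ico, hleft _ (by linarith), hleft _ (by linarith),
      ENNReal.toReal_ofReal (sub_nonneg.2 (monotone_cdf ν (by linarith)))]
    ring
  · have hme : MeasurableEmbedding (Neg.neg : ℝ → ℝ) :=
      (MeasurableEquiv.neg ℝ).measurableEmbedding
    rw [hme.integrable_map_iff]
    simpa [Function.comp_def] using hφi
  · intro z hz
    rw [← intervalIntegral.integral_of_le hz.le, intervalIntegral.integral_comp_neg, neg_neg,
      intervalIntegral.integral_of_le (by linarith)]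
    exact h _ (by linarith)

/-- A function with nonnegative integral over every interval that has the mode as an endpoint has
nonnegative expectation under a unimodal law. -/
theorem integral_nonneg_of_convexOn_of_concaveOn {ν : Measure ℝ} [IsProbabilityMeasure ν]
    {φ : ℝ → ℝ} {a : ℝ} (hconv : ConvexOn ℝ (Set.Iio a) (fun t => cdf ν t))
    (hconc : ConcaveOn ℝ (Set.Ioi a) (fun t => cdf ν t))
    (hφm : Measurable φ) (hφi : Integrable φ ν) (ha : 0 ≤ φ a)
    (hleft : ∀ z, z < a → 0 ≤ ∫ x in z..a, φ x) (hright : ∀ z, a < z → 0 ≤ ∫ x in a..z, φ x) :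
    0 ≤ ∫ x, φ x ∂ν := by
  have h1 : 0 ≤ ∫ x in Set.Iio a, φ x ∂ν :=
    setIntegral_Iio_nonneg_of_convexOn hconv hφm hφi fun z hz => by
      rw [← intervalIntegral.integral_of_le hz.le]; exact hleft z hz
  have h2 : 0 ≤ ∫ x in Set.Ioi a, φ x ∂ν := by
    refine setIntegral_Ioi_nonneg_of_concaveOn hconc (fun x y hx hxy => ?_) hφm hφi fun z hz => by
      rw [← intervalIntegral.integral_of_le hz.le]; exact hright z hz
    rw [measureReal_def]
    nth_rewrite 1 [← measure_cdf ν]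
    rw [StieltjesFunction.measure_Ioc,
      ENNReal.toReal_ofReal (sub_nonneg.2 (monotone_cdf ν hxy))]
  -- The mode may carry an atom.
  have h3 : 0 ≤ ∫ x in {a}, φ x ∂ν := by
    rw [integral_singleton]
    exact mul_nonneg measureReal_nonneg ha
  have h4 : ∫ x in Set.Ici a, φ x ∂ν = ∫ x in {a}, φ x ∂ν + ∫ x in Set.Ioi a, φ x ∂ν := by
    rw [← Set.Ioi_insert, Set.insert_eq, setIntegral_union (by simp) measurableSet_Ioi
      hφi.integrableOn hφi.integrableOn]
  have h5 := integral_add_compl (measurableSet_Iio (a := a)) hφi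
  rw [Set.compl_Iio, h4] at h5
  linarith

/-! ### Quadratic test functions and the tail bound. -/

theorem intervalIntegral_indicator_Ioi {u v c : ℝ} (huv : u ≤ v) (C : ℝ) :
    ∫ y in u..v, (Set.Ioi c).indicator (fun _ => C) y = C * (max v c - max u c) := by
  rw [intervalIntegral.integral_of_le huv, integral_indicator_const _ measurableSet_Ioi,
    measureReal_restrict_apply measurableSet_Ioi, Set.inter_comm, Set.Ioc_inter_Ioi,
    Real.volume_real_Ioc, smul_eq_mul, mul_comm]
  congr 1
  rcases le_total v c with h | h
  · have hu : u ≤ c := huv.trans h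
    rw [max_eq_right hu, max_eq_right h]
    simpa using h
  · rw [max_eq_left h, max_eq_left]
    simp [huv, h]

theorem intervalIntegral_quadratic_sub_indicator {u v : ℝ} (huv : u ≤ v) (A B C : ℝ) :
    ∫ y in u..v, (A * y ^ 2 + B - (Set.Ioi 1).indicator (fun _ => C) y)
      = A * (v ^ 3 - u ^ 3) / 3 + B * (v - u) - C * (max v 1 - max u 1) := by
  have hi : IntervalIntegrable ((Set.Ioi (1 : ℝ)).indicator fun _ => C) volume u v := by
    rw [intervalIntegrable_iff_integrableOn_Ioc_of_le huv]
    exact (integrableOn_const (by simp)).indicator measurableSet_Ioi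
  have hq : IntervalIntegrable (fun y : ℝ => A * y ^ 2 + B) volume u v :=
    Continuous.intervalIntegrable (by fun_prop) _ _
  rw [intervalIntegral.integral_sub hq hi, intervalIntegral_indicator_Ioi huv,
    intervalIntegral.integral_add (Continuous.intervalIntegrable (by fun_prop) _ _) (by simp),
    intervalIntegral.integral_const_mul, integral_pow, intervalIntegral.integral_const,
    smul_eq_mul]
  norm_num
  ring

/-- A linear inequality between a tail probability and a second moment holds for a unimodal law if
it holds for the uniform laws on the intervals that have the mode `d + R * b` as an endpoint. -/
theorem mul_tail_le_of_convexOn_of_concaveOn {ν : Measure ℝ} [IsProbabilityMeasure ν]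
    {d R b A B C : ℝ} (hR : 0 < R)
    (hconv : ConvexOn ℝ (Set.Iio (d + R * b)) (fun t => cdf ν t))
    (hconc : ConcaveOn ℝ (Set.Ioi (d + R * b)) (fun t => cdf ν t))
    (hint : Integrable (fun x => ((x - d) / R) ^ 2) ν)
    (hb : 0 ≤ A * b ^ 2 + B - (Set.Ioi 1).indicator (fun _ => C) b)
    (hleft : ∀ z < b, 0 ≤ A * (b ^ 3 - z ^ 3) / 3 + B * (b - z) - C * (max b 1 - max z 1))
    (hright : ∀ z > b, 0 ≤ A * (z ^ 3 - b ^ 3) / 3 + B * (z - b) - C * (max z 1 - max b 1)) :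
    C * ν.real {x | 1 < (x - d) / R} ≤ A * (∫ x, ((x - d) / R) ^ 2 ∂ν) + B := by
  set ψ : ℝ → ℝ := fun y => A * y ^ 2 + B - (Set.Ioi 1).indicator (fun _ => C) y with hψ
  have hψm : Measurable ψ := by
    refine Measurable.sub (by fun_prop) (measurable_const.indicator measurableSet_Ioi)
  have hT : MeasurableSet {x | 1 < (x - d) / R} :=
    measurableSet_lt measurable_const (by fun_prop)
  have hcomp : (fun x => ψ ((x - d) / R)) = fun x => A * ((x - d) / R) ^ 2 + B
      - {x | 1 < (x - d) / R}.indicator (fun _ => C) x := by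
    ext x
    simp [ψ, Set.indicator]
  have hind : Integrable ({x | 1 < (x - d) / R}.indicator fun _ => C) ν :=
    (integrable_const C).indicator hT
  have hq : Integrable (fun x => A * ((x - d) / R) ^ 2 + B) ν :=
    (hint.const_mul A).add (integrable_const B)
  have hbase : (d + R * b - d) / R = b := by field_simp; ring
  have hscale : ∀ u v, ∫ x in u..v, ψ ((x - d) / R) = R * ∫ y in (u - d) / R..(v - d) / R, ψ y := by
    intro u v
    rw [intervalIntegral.integral_comp_sub_right (fun x => ψ (x / R)),
      intervalIntegral.integral_comp_div _ hR.ne', smul_eq_mul]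
  have key : 0 ≤ ∫ x, ψ ((x - d) / R) ∂ν := by
    refine integral_nonneg_of_convexOn_of_concaveOn hconv hconc
      (hψm.comp (by fun_prop)) (by rw [hcomp]; exact hq.sub hind) ?_ ?_ ?_
    · rw [hbase]; exact hb
    · intro z hz
      have hz' : (z - d) / R < b := by rw [div_lt_iff₀ hR]; linarith
      rw [hscale, hbase, intervalIntegral_quadratic_sub_indicator hz'.le]
      exact mul_nonneg hR.le (hleft _ hz')
    · intro z hz
      have hz' : b < (z - d) / R := by rw [lt_div_iff₀ hR]; linarith
      rw [hscale, hbase, intervalIntegral_quadratic_sub_indicator hz'.le]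
      exact mul_nonneg hR.le (hright _ hz')
  rw [hcomp, integral_sub hq hind, integral_add (hint.const_mul A) (integrable_const B),
    integral_const_mul, integral_indicator_const _ hT] at key
  simp only [integral_const, probReal_univ, smul_eq_mul, one_mul] at key
  linarith

/-- This is three times the `hright` condition for mode `b ∈ [0, 1]` and `z ≥ 1`. Equality holds at
`(b, z) = (0, 3/2)` and `(1, 1)`; with `w = z - 1`, `e = 1 - b`, the square of `2w - e` vanishes at
both. -/
theorem cubic_nonneg_of_one_le {b z : ℝ} (hb : 0 ≤ b) (hb1 : b ≤ 1) (hz : 1 ≤ z) :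
    0 ≤ 4 * z ^ 3 - 27 * z + 27 + 15 * b ^ 2 * z - b ^ 3 - 18 * b ^ 2 := by
  obtain ⟨w, rfl⟩ : ∃ w, z = 1 + w := ⟨z - 1, by ring⟩
  obtain ⟨e, rfl⟩ : ∃ e, b = 1 - e := ⟨1 - b, by ring⟩
  have hw : 0 ≤ w := by linarith
  have he : 0 ≤ e := by linarith
  nlinarith [mul_nonneg hw (sq_nonneg (2 * w - e)), mul_nonneg hw (sq_nonneg (2 * w - 1)),
    mul_nonneg he (sq_nonneg (2 * w - e)), mul_nonneg he (sq_nonneg (2 * w - 1)),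
    mul_nonneg he hb, mul_nonneg (mul_nonneg he hb) hw, mul_nonneg (mul_nonneg he hb) he,
    mul_nonneg hb (sq_nonneg (2 * w - e)), mul_nonneg hw (sq_nonneg e)]

/-- The Vysochanskij–Petunin bound for an upper tail, in the regime of small second moment. -/
theorem IsUnimodal.tail_le {ν : Measure ℝ} [IsProbabilityMeasure ν] (hu : IsUnimodal ν)
    {d R : ℝ} (hR : 0 < R) (hint : Integrable (fun x => ((x - d) / R) ^ 2) ν)
    (hs : ∫ x, ((x - d) / R) ^ 2 ∂ν ≤ 3 / 8) :
    ν.real {x | 1 < (x - d) / R} ≤ 4 / 9 * ∫ x, ((x - d) / R) ^ 2 ∂ν := by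
  obtain ⟨a, hconv, hconc⟩ := hu
  obtain ⟨b, rfl⟩ : ∃ b, a = d + R * b := ⟨(a - d) / R, by field_simp; ring⟩
  have hcube : ∀ {x y : ℝ}, x ≤ y → x ^ 3 ≤ y ^ 3 := fun h =>
    (Odd.strictMono_pow (by decide : Odd 3)).monotone h
  rcases lt_or_ge b 0 with hb0 | hb0
  · have hb3 : b ^ 3 ≤ 0 := by simpa using hcube hb0.le
    -- `4/9` is the extremal slope: at `b = 0`, `4z³/27 - (z - 1) = (2z - 3)²(z + 3)/27`.
    have := mul_tail_le_of_convexOn_of_concaveOn (A := 4 / 9) (B := 0) (C := 1) hR hconv hconc hint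
      ?_ ?_ ?_
    · linarith
    · rw [Set.indicator_of_notMem (by simp; linarith)]
      nlinarith [sq_nonneg b]
    · intro z hz
      rw [max_eq_right (by linarith), max_eq_right (by linarith)]
      linarith [hcube hz.le]
    · intro z hz
      rw [max_eq_right (by linarith : b ≤ 1)]
      rcases le_total z 1 with h1 | h1
      · rw [max_eq_right h1]
        linarith [hcube (le_of_lt hz)]
      · rw [max_eq_left h1]
        nlinarith [mul_nonneg (sq_nonneg (2 * z - 3)) (by linarith : 0 ≤ z + 3)]
  rcases le_or_gt b 1 with hb1 | hb1
  · have := mul_tail_le_of_convexOn_of_concaveOn (A := 4) (B := -b ^ 2) (C := 9 - 6 * b ^ 2) hR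
      hconv hconc hint ?_ ?_ ?_
    · set s := ∫ x, ((x - d) / R) ^ 2 ∂ν
      set p := ν.real {x | 1 < (x - d) / R}
      have hpos : 0 < 9 - 6 * b ^ 2 := by nlinarith
      refine le_of_mul_le_mul_left (this.trans ?_) hpos
      nlinarith [mul_nonneg (sq_nonneg b) (sub_nonneg.2 hs)]
    · rw [Set.indicator_of_notMem (by simpa using hb1)]
      nlinarith [sq_nonneg b]
    · intro z hz
      rw [max_eq_right (by linarith), max_eq_right (by linarith)]
      nlinarith [mul_nonneg (sub_nonneg.2 hz.le) (sq_nonneg (b + 2 * z))]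
    · intro z hz
      rw [max_eq_right hb1]
      rcases le_total z 1 with h1 | h1
      · rw [max_eq_right h1]
        nlinarith [mul_nonneg (sub_nonneg.2 (le_of_lt hz)) (sq_nonneg (b + 2 * z))]
      · rw [max_eq_left h1]
        nlinarith [cubic_nonneg_of_one_le hb0 hb1 h1]
  · have := mul_tail_le_of_convexOn_of_concaveOn (A := 4) (B := -1) (C := 3) hR
      hconv hconc hint ?_ ?_ ?_
    · linarith
    · rw [Set.indicator_of_mem (by simpa using hb1)]
      nlinarith
    · intro z hz
      rw [max_eq_left hb1.le]
      rcases le_total z 1 with h1 | h1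
      · rw [max_eq_right h1]
        nlinarith [mul_nonneg (sq_nonneg (b - 1)) (by linarith : 0 ≤ b + 2),
          mul_nonneg (sub_nonneg.2 h1) (sq_nonneg (2 * z + 1))]
      · rw [max_eq_left h1]
        nlinarith [mul_nonneg (sub_nonneg.2 hz.le)
          (by nlinarith : 0 ≤ b ^ 2 + b * z + z ^ 2 - 3)]
    · intro z hz
      have hz' : b < z := hz
      rw [max_eq_left hb1.le, max_eq_left (by linarith)]
      nlinarith [mul_nonneg (sub_nonneg.2 hz'.le)
          (by nlinarith : 0 ≤ b ^ 2 + b * z + z ^ 2 - 3)]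

/-! ### From the tail bound to mean and standard deviation. -/

/-- The one-sided Vysochanskij–Petunin inequality. -/
theorem measureReal_lt_le_of_isUnimodal {Ω : Type*} [MeasurableSpace Ω] {P : Measure Ω}
    [IsProbabilityMeasure P] {X : Ω → ℝ} (hX : MemLp X 2 P) (hu : IsUnimodal (P.map X))
    {l h : ℝ} (hl0 : 0 ≤ l) (hl : 5 / 3 ≤ l ^ 2) (hh : (∫ ω, X ω ∂P) + l * std P X ≤ h) :
    P.real {ω | h < X ω} ≤ 4 / (9 * (l ^ 2 + 1)) := by
  set m := ∫ ω, X ω ∂P with hm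
  set σ := std P X with hσ
  have hσ2 : σ ^ 2 = ∫ ω, (X ω - m) ^ 2 ∂P := by
    rw [hσ, std, Real.sq_sqrt (variance_nonneg X P), variance_eq_integral hX.aemeasurable]
  have hσ0 : 0 ≤ σ := Real.sqrt_nonneg _
  have hX1 : Integrable X P := hX.integrable (by norm_num)
  have hX2 : MemLp (fun ω => X ω - m) 2 P := hX.sub (memLp_const m)
  -- If `σ = 0`, the scale `R` below would vanish; then `X = m ≤ h` almost surely.
  rcases hσ0.eq_or_lt with h0 | hpos
  · rw [← h0] at hσ2 hh
    have hae : (fun ω => (X ω - m) ^ 2) =ᵐ[P] 0 :=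
      (integral_eq_zero_iff_of_nonneg (fun ω => sq_nonneg _) hX2.integrable_sq).1
        (by rw [← hσ2]; norm_num)
    have hnull : P {ω | h < X ω} = 0 := by
      refine measure_mono_null ?_ (ae_iff.1 hae)
      intro ω hω hz
      have h1 : X ω - m = 0 := by simpa using hz
      have h2 : h < X ω := hω
      linarith
    rw [measureReal_def, hnull]
    simp only [ENNReal.toReal_zero]
    positivity
  have hlpos : 0 < l := by
    rcases hl0.eq_or_lt with h0 | h0
    · rw [← h0] at hl; norm_num at hl
    · exact h0
  -- Cantelli's shift: `d + R = m + l * σ`, and the rescaled second moment is `1 / (l ^ 2 + 1)`.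
  set d := m - σ / l with hd
  set R := l * σ + σ / l with hRdef
  have hR : 0 < R := by positivity
  have hprob : IsProbabilityMeasure (P.map X) := Measure.isProbabilityMeasure_map hX.aemeasurable
  have hY : MemLp (fun ω => (X ω - d) / R) 2 P := by
    simpa only [div_eq_inv_mul] using
      (show MemLp (fun ω => X ω - d) 2 P from hX.sub (memLp_const d)).const_mul R⁻¹
  have hsm : AEStronglyMeasurable (fun x => ((x - d) / R) ^ 2) (P.map X) :=
    Measurable.aestronglyMeasurable (by fun_prop)
  have hval : ∫ x, ((x - d) / R) ^ 2 ∂(P.map X) = 1 / (l ^ 2 + 1) := by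
    rw [integral_map hX.aemeasurable hsm]
    have hexp : ∀ ω, ((X ω - d) / R) ^ 2
        = (1 / R ^ 2) * ((X ω - m) ^ 2 + (2 * (σ / l)) * (X ω - m) + (σ / l) ^ 2) := by
      intro ω
      rw [hd]
      field_simp
      ring
    have hlin : ∫ ω, (X ω - m) ∂P = 0 := by
      rw [integral_sub hX1 (integrable_const m)]
      simp [hm]
    have hi1 : Integrable (fun ω => (2 * (σ / l)) * (X ω - m)) P :=
      (hX1.sub (integrable_const m)).const_mul _
    have hi2 : Integrable (fun ω => (X ω - m) ^ 2 + (2 * (σ / l)) * (X ω - m)) P :=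
      hX2.integrable_sq.add hi1
    simp only [hexp]
    rw [integral_const_mul, integral_add hi2 (integrable_const _),
      integral_add hX2.integrable_sq hi1, integral_const_mul, hlin, ← hσ2]
    simp only [integral_const, probReal_univ, smul_eq_mul]
    rw [hRdef]
    field_simp
    ring
  have key := hu.tail_le hR ((integrable_map_measure hsm hX.aemeasurable).2 hY.integrable_sq) (by
    rw [hval, div_le_div_iff₀ (by positivity) (by norm_num)]
    linarith)
  rw [hval, map_measureReal_apply_of_aemeasurable hX.aemeasurable
    (measurableSet_lt measurable_const (by fun_prop))] at key
  calc P.real {ω | h < X ω} ≤ P.real (X ⁻¹' {x | 1 < (x - d) / R}) := by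
        refine measureReal_mono fun ω hω => ?_
        have h2 : h < X ω := hω
        simp only [Set.mem_preimage, Set.mem_ofPred_eq]
        rw [lt_div_iff₀ hR, hRdef, hd]
        linarith
    _ ≤ 4 / 9 * (1 / (l ^ 2 + 1)) := key
    _ = 4 / (9 * (l ^ 2 + 1)) := by field_simp

/-! ### The controlled system and the union bound. -/

theorem memLp_state {Ω : Type*} [MeasurableSpace Ω] {P : Measure Ω} [IsProbabilityMeasure P]
    {n m N : ℕ} (A : Matrix (Fin n) (Fin n) ℝ) {B : Fin N → Ω → Matrix (Fin n) (Fin m) ℝ}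
    (x₀ : Fin n → ℝ) (U : Fin N → Fin m → ℝ)
    (hB : ∀ (k : Fin N) (r : Fin n) (c : Fin m), MemLp (fun ω => B k ω r c) 2 P)
    (k : Fin (N + 1)) : ∀ r, MemLp (fun ω => state A B x₀ U k ω r) 2 P := by
  induction k using Fin.induction with
  | zero => exact fun r => memLp_const (x₀ r)
  | succ j ih =>
    intro r
    have hstep : ∀ ω, state A B x₀ U j.succ ω r
        = ∑ c, A r c * state A B x₀ U j.castSucc ω c + ∑ c, B j ω r c * U j c := by
      intro ω
      simp only [state, Fin.induction_succ, Pi.add_apply, Matrix.mulVec, dotProduct]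
    simp only [hstep]
    refine MemLp.add (memLp_finsetSum _ fun c _ => (ih c).const_mul _)
      (memLp_finsetSum _ fun c _ => (hB j r c).mul_const _)

theorem lemma1 {Ω : Type*} [MeasurableSpace Ω] (P : Measure Ω) [IsProbabilityMeasure P]
    {n m N : ℕ} (A : Matrix (Fin n) (Fin n) ℝ)
    (B : Fin N → Ω → Matrix (Fin n) (Fin m) ℝ)
    (x₀ : Fin n → ℝ) (U : Fin N → Fin m → ℝ)
    (q : Fin N → ℕ) (G : (k : Fin N) → Fin (q k) → Fin n → ℝ) (h : (k : Fin N) → Fin (q k) → ℝ)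
    (α : ℝ) (hα : α < 1 / 6)
    (hB : ∀ (k : Fin N) (r : Fin n) (c : Fin m), MemLp (fun ω => B k ω r c) 2 P)
    (hG : ∀ (k : Fin N) (i : Fin (q k)), IsUnimodal (P.map (constraintVar A B x₀ U G k i)))
    (hlam : ∃ lam : (k : Fin N) → Fin (q k) → ℝ,
      (∀ k i, 0 ≤ lam k i) ∧
      (∀ k i, (∫ ω, constraintVar A B x₀ U G k i ω ∂P)
        + lam k i * std P (constraintVar A B x₀ U G k i) ≤ h k i) ∧
      ∑ k : Fin N, ∑ i : Fin (q k), 4 / (9 * (lam k i ^ 2 + 1)) ≤ α) :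
    1 - α ≤ P.real (⋂ (k : Fin N), ⋂ (i : Fin (q k)),
      {ω | constraintVar A B x₀ U G k i ω ≤ h k i}) := by
  obtain ⟨lam, hlam0, hmean, hsum⟩ := hlam
  have hterm : ∀ k i, 4 / (9 * (lam k i ^ 2 + 1)) ≤ α := by
    intro k i
    refine le_trans ?_ hsum
    refine le_trans ?_ (Finset.single_le_sum
      (f := fun k => ∑ i : Fin (q k), 4 / (9 * (lam k i ^ 2 + 1)))
      (fun k _ => Finset.sum_nonneg fun i _ => by positivity) (Finset.mem_univ k))
    exact Finset.single_le_sum (f := fun i => 4 / (9 * (lam k i ^ 2 + 1)))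
      (fun i _ => by positivity) (Finset.mem_univ i)
  have hviol : ∀ k i, P.real {ω | h k i < constraintVar A B x₀ U G k i ω}
      ≤ 4 / (9 * (lam k i ^ 2 + 1)) := by
    intro k i
    have hmem : MemLp (constraintVar A B x₀ U G k i) 2 P := by
      unfold constraintVar dotProduct
      exact memLp_finsetSum _ fun c _ => (memLp_state A x₀ U hB k.succ c).const_mul _
    refine measureReal_lt_le_of_isUnimodal hmem (hG k i) (hlam0 k i) ?_ (hmean k i)
    -- `4 / (9(λ² + 1)) < 1/6` means `λ² > 5/3`.
    have h1 := (hterm k i).trans_lt hα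
    rw [div_lt_div_iff₀ (by positivity) (by norm_num)] at h1
    linarith
  set S := ⋂ (k : Fin N), ⋂ (i : Fin (q k)), {ω | constraintVar A B x₀ U G k i ω ≤ h k i} with hS
  have hcompl : Sᶜ = ⋃ (k : Fin N), ⋃ (i : Fin (q k)),
      {ω | h k i < constraintVar A B x₀ U G k i ω} := by
    ext ω
    simp [hS]
  have hbound : P.real Sᶜ ≤ α := by
    rw [hcompl]
    refine (measureReal_iUnion_fintype_le _).trans (le_trans ?_ hsum)
    refine Finset.sum_le_sum fun k _ => (measureReal_iUnion_fintype_le _).trans ?_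
    exact Finset.sum_le_sum fun i _ => hviol k i
  -- Subadditivity suffices, so measurability of `S` is not needed.
  have hone : (1 : ℝ) ≤ P.real S + P.real Sᶜ := by
    rw [← probReal_univ (μ := P), ← Set.union_compl_self S]
    exact measureReal_union_le _ _
  linarith
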